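/- Let $n\ge 3$ and let $$G=\langle x_1,\dots,x_n \mid x_i^{-1}x_j^2x_i=x_j^{-2}\ \text{ for all } i\ne j\rangle ,$$ let $A=\langle x_1^2,\dots,x_n^2\rangle\le G$, which is a normal subgroup, free abelian with basis $x_1^2,\dots,x_n^2$, and let $W=G/A$. Let $M$ be the set of integral $n\times n$ matrices with the monoid operation $$(\mathfrak a*\mathfrak b)_{ij}=a_{ij}+(1+2a_{jj})\,b_{ij}$$ (the identity element is the zero matrix), and let $M^*$ be its group of units. For $\mathfrak a=[a_{ij}]\in M$ let $t_{\mathfrak a}$ be the endomorphism of $G$ with $t_{\mathfrak a}(x_i)=x_i\,(x_1^2)^{a_{i1}}\cdots(x_n^2)^{a_{in}}$ for all $i$; then $t_{\mathfrak a}\circ t_{\mathfrak b}=t_{\mathfrak a*\mathfrak b}$, so that $t:\mathfrak a\mapsto t_{\mathfrak a}$ is a homomorphism $M^*\to\mathrm{Aut}(G)$. Let $\iota:A\to M^*$ be the homomorphism sending $a=(x_1^2)^{a_1}\cdots(x_n^2)^{a_n}$ to the matrix whose diagonal entries are $0$ and whose entry in row $i$ and column $j\neq i$ is $-2a_j$;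 then $t_{\iota(a)}$ is conjugation $g\mapsto aga^{-1}$, and $\iota(A)$ is normal in $M^*$. Then $A$ is a characteristic subgroup of $G$, so that every automorphism of $G$ induces one of $W$, and the diagram $$\begin{array}{ccccccccc} & & 1 & & 1 & & 1 & & \\ & & \downarrow & & \downarrow & & \downarrow & & \\ 1 & \to & A & \to & G & \to & W & \to & 1\\ & & {\scriptstyle\iota}\downarrow\ & & \downarrow & & \downarrow & & \\ 1 & \to & M^* & \xrightarrow{\ t\ } & \mathrm{Aut}(G) & \to & \mathrm{Aut}(W) & \to & 1\\ & & \downarrow & & \downarrow & & \downarrow & & \\ 1 & \to & M^*/\iota(A) & \to & \mathrm{Out}(G) & \to & \mathrm{Out}(W) & \to & 1\\ & & \downarrow & & \downarrow & & \downarrow & & \\ & & 1 & & 1 & & 1 & & \end{array}$$ is commutative and all of its rows and columns are exact. Here $A\to G$ is the inclusion, $G\to W$ and the maps from the second to the third row are the canonical projections, $G\to\mathrm{Aut}(G)$ and $W\to\mathrm{Aut}(W)$ send $g$ to the conjugation $y\mapsto gyg^{-1}$, $\mathrm{Aut}(G)\to\mathrm{Aut}(W)$ sends an automorphism to the one it induces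 on $W=G/A$, $M^*/\iota(A)\to\mathrm{Out}(G)$ is $\mathfrak a\,\iota(A)\mapsto t_{\mathfrak a}\mathrm{Inn}(G)$, and $\mathrm{Out}(G)\to\mathrm{Out}(W)$ is induced by $\mathrm{Aut}(G)\to\mathrm{Aut}(W)$. -/

import Mathlib

namespace HantzscheWendt

section General

/-- `1 → K → H → Q → 1` is a short exact sequence of groups. -/
def IsShortExact {K H Q : Type*} [Group K] [Group H] [Group Q] (f : K →* H) (g : H →* Q) : Prop :=
  Function.Injective f ∧ f.range = g.ker ∧ Function.Surjective g

/-- The group `Inn(H)` of inner automorphisms `h ↦ (x ↦ h x h⁻¹)`, as a subgroup of `Aut(H)`. -/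
def Inn (H : Type*) [Group H] : Subgroup (MulAut H) := (MulAut.conj : H →* MulAut H).range

instance (H : Type*) [Group H] : (Inn H).Normal := by
  refine ⟨?_⟩
  rintro _ ⟨h, rfl⟩ f
  exact ⟨f h, by ext x; simp [MulAut.mul_apply]⟩

/-- The outer automorphism group `Out(H) = Aut(H) / Inn(H)`. -/
abbrev Out (H : Type*) [Group H] : Type _ := MulAut H ⧸ Inn H

/-- The canonical projection `Aut(H) → Out(H)`. -/
def toOut (H : Type*) [Group H] : MulAut H →* Out H := QuotientGroup.mk' (Inn H)

variable {H : Type*} [Group H]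

lemma map_eq_of_characteristic {N : Subgroup H} (hN : N.Characteristic) (f : MulAut H) :
    N.map (f : H →* H) = N :=
  (Subgroup.characteristic_iff_map_eq.1 hN) f

/-- For a characteristic subgroup `N` of `H`, the homomorphism `Aut(H) → Aut(H/N)` sending an
automorphism `f` to the induced automorphism `hN ↦ f(h)N`. -/
def autQuot (N : Subgroup H) [N.Normal] (hN : N.Characteristic) : MulAut H →* MulAut (H ⧸ N) where
  toFun f := QuotientGroup.congr N N f (map_eq_of_characteristic hN f)
  map_one' := by
    ext x
    obtain ⟨h, rfl⟩ := QuotientGroup.mk_surjective x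
    rfl
  map_mul' f g := by
    ext x
    obtain ⟨h, rfl⟩ := QuotientGroup.mk_surjective x
    rfl

lemma autQuot_conj (N : Subgroup H) [N.Normal] (hN : N.Characteristic) (h : H) :
    autQuot N hN (MulAut.conj h) = MulAut.conj (h : H ⧸ N) := by
  ext x
  obtain ⟨y, rfl⟩ := QuotientGroup.mk_surjective x
  rfl

/-- The homomorphism `Out(H) → Out(H/N)` induced by `Aut(H) → Aut(H/N)`. -/
def outQuot (N : Subgroup H) [N.Normal] (hN : N.Characteristic) : Out H →* Out (H ⧸ N) :=
  QuotientGroup.map (Inn H) (Inn (H ⧸ N)) (autQuot N hN) (by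
    rintro _ ⟨h, rfl⟩
    exact ⟨(h : H ⧸ N), (autQuot_conj N hN h).symm⟩)

end General

/-! ### The combinatorial Hantzsche-Wendt group -/

/-- The relators `x_i⁻¹ x_j² x_i x_j²` for `i ≠ j`. -/
def rels (n : ℕ) : Set (FreeGroup (Fin n)) :=
  {r | ∃ i j : Fin n, i ≠ j ∧
    r = (FreeGroup.of i)⁻¹ * FreeGroup.of j ^ 2 * FreeGroup.of i * FreeGroup.of j ^ 2}

/-- `G_n = ⟨x_1, …, x_n | x_i⁻¹ x_j² x_i = x_j⁻² for i ≠ j⟩`. -/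
abbrev G (n : ℕ) : Type := PresentedGroup (rels n)

variable {n : ℕ}

/-- The generators of `G_n`. -/
def x (i : Fin n) : G n := PresentedGroup.of i

lemma x_rel {i j : Fin n} (h : i ≠ j) : (x i)⁻¹ * x j ^ 2 * x i = (x j ^ 2)⁻¹ := by
  have : PresentedGroup.mk (rels n)
      ((FreeGroup.of i)⁻¹ * FreeGroup.of j ^ 2 * FreeGroup.of i * FreeGroup.of j ^ 2) = 1 :=
    PresentedGroup.one_of_mem ⟨i, j, h, rfl⟩
  simp only [map_mul, map_inv, map_pow] at this
  exact eq_inv_of_mul_eq_one_left this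

lemma rels_lift {K : Type*} [Group K] (f : Fin n → K)
    (h : ∀ i j, i ≠ j → (f i)⁻¹ * f j ^ 2 * f i = (f j ^ 2)⁻¹) :
    ∀ r ∈ rels n, FreeGroup.lift f r = 1 := by
  rintro _ ⟨i, j, hij, rfl⟩
  simp only [map_mul, map_inv, map_pow, FreeGroup.lift_apply_of]
  rw [h i j hij]
  simp

/-- The homomorphism out of `G_n` with prescribed values on the generators. -/
def lift {K : Type*} [Group K] (f : Fin n → K)
    (h : ∀ i j, i ≠ j → (f i)⁻¹ * f j ^ 2 * f i = (f j ^ 2)⁻¹) : G n →* K :=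
  PresentedGroup.toGroup (rels_lift f h)

@[simp] lemma lift_x {K : Type*} [Group K] (f : Fin n → K)
    (h : ∀ i j, i ≠ j → (f i)⁻¹ * f j ^ 2 * f i = (f j ^ 2)⁻¹) (i : Fin n) :
    lift f h (x i) = f i :=
  PresentedGroup.toGroup.of (rels_lift f h)

lemma hom_ext {K : Type*} [Monoid K] {f g : G n →* K} (h : ∀ i, f (x i) = g (x i)) : f = g := by
  refine MonoidHom.eq_of_eqOn_dense (PresentedGroup.closure_range_of (rels n)) ?_
  rintro _ ⟨i, rfl⟩
  exact h i

/-- `A_n`, the subgroup of `G_n` generated by `x_1², …, x_n²`. -/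
def A (n : ℕ) : Subgroup (G n) := Subgroup.closure (Set.range fun i : Fin n => x i ^ 2)

lemma sq_mem (i : Fin n) : x i ^ 2 ∈ A n := Subgroup.subset_closure ⟨i, rfl⟩

lemma conj_sq (i j : Fin n) :
    (x i)⁻¹ * x j ^ 2 * x i = if j = i then x j ^ 2 else (x j ^ 2)⁻¹ := by
  split_ifs with h
  · subst h; group
  · exact x_rel (Ne.symm h)

lemma conj_sq' (i j : Fin n) :
    x i * x j ^ 2 * (x i)⁻¹ = if j = i then x j ^ 2 else (x j ^ 2)⁻¹ := by
  split_ifs with h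
  · subst h; group
  · have h2 : x j ^ 2 = (x i)⁻¹ * (x j ^ 2)⁻¹ * x i := by
      have := congrArg (fun g => g⁻¹) (x_rel (Ne.symm h))
      simp only [mul_inv_rev, inv_inv] at this
      rw [mul_assoc]
      exact this.symm
    calc x i * x j ^ 2 * (x i)⁻¹ = x i * ((x i)⁻¹ * (x j ^ 2)⁻¹ * x i) * (x i)⁻¹ := by rw [← h2]
      _ = _ := by group

instance : (A n).Normal := by
  rw [← Subgroup.normalizer_eq_top_iff, eq_top_iff, ← PresentedGroup.closure_range_of (rels n),
    Subgroup.closure_le]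
  rintro _ ⟨i, rfl⟩
  change x i ∈ Subgroup.normalizer _
  have key : ∀ g : G n, (∀ j, g * x j ^ 2 * g⁻¹ ∈ A n) → ∀ a ∈ A n, g * a * g⁻¹ ∈ A n := by
    intro g hg a ha
    have : A n ≤ (A n).comap (MulAut.conj g).toMonoidHom := by
      rw [A, Subgroup.closure_le]
      rintro _ ⟨j, rfl⟩
      exact hg j
    exact this ha
  rw [Subgroup.mem_normalizer_iff]
  intro a
  refine ⟨key _ (fun j => ?_) a, fun h => ?_⟩
  · rw [conj_sq']
    split_ifs
    · exact sq_mem j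
    · exact inv_mem (sq_mem j)
  · have := key (x i)⁻¹ (fun j => ?_) _ h
    · simpa [mul_assoc] using this
    · rw [inv_inv, conj_sq]
      split_ifs
      · exact sq_mem j
      · exact inv_mem (sq_mem j)

lemma sq_comm (i j : Fin n) : x i ^ 2 * x j ^ 2 = x j ^ 2 * x i ^ 2 := by
  have h : x i * x j ^ 2 * (x i)⁻¹ = x j ^ 2 ∨ x i * x j ^ 2 * (x i)⁻¹ = (x j ^ 2)⁻¹ := by
    rw [conj_sq']; split_ifs <;> simp
  have h2 : x i ^ 2 * x j ^ 2 * (x i ^ 2)⁻¹ = x j ^ 2 := by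
    have e : x i ^ 2 * x j ^ 2 * (x i ^ 2)⁻¹
        = x i * (x i * x j ^ 2 * (x i)⁻¹) * (x i)⁻¹ := by
      simp only [pow_two, mul_inv_rev, mul_assoc]
    rcases h with h | h
    · rw [e, h, h]
    · rw [e, h, ← conj_inv, h, inv_inv]
  exact mul_inv_eq_iff_eq_mul.1 h2

instance : CommGroup (A n) :=
  { (inferInstance : Group (A n)) with
    mul_comm := by
      have : IsMulCommutative (A n) := by
        refine Subgroup.isMulCommutative_closure ?_
        rintro _ ⟨i, rfl⟩ _ ⟨j, rfl⟩
        exact sq_comm i j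
      exact this.is_comm.comm }

/-- `W_n = G_n / A_n`. -/
abbrev W (n : ℕ) : Type := G n ⧸ A n

/-- `x_i²` as an element of `A_n`. -/
def sq (i : Fin n) : A n := ⟨x i ^ 2, sq_mem i⟩

/-- The homomorphism `ℤⁿ → A_n`, `z ↦ (x_1²)^{z_1} ⋯ (x_n²)^{z_n}`. -/
def sqHom (n : ℕ) : Multiplicative (Fin n → ℤ) →* A n where
  toFun z := ∏ i, sq i ^ (z.toAdd i)
  map_one' := by simp
  map_mul' y z := by simp [zpow_add, Finset.prod_mul_distrib]

/-- `(x_1²)^{z_1} ⋯ (x_n²)^{z_n}` as an element of `G_n`. -/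
def sqProd (z : Fin n → ℤ) : G n := (sqHom n (Multiplicative.ofAdd z) : A n)

lemma sqProd_mem (z : Fin n → ℤ) : sqProd z ∈ A n := Subtype.property _

lemma sqProd_add (y z : Fin n → ℤ) : sqProd (y + z) = sqProd y * sqProd z := by
  simp [sqProd]

lemma sqProd_single (i : Fin n) (k : ℤ) : sqProd (Pi.single i k) = (x i ^ 2) ^ k := by
  have : sqHom n (Multiplicative.ofAdd (Pi.single i k)) = sq i ^ k := by
    change ∏ j, sq j ^ (Pi.single i k : Fin n → ℤ) j = _
    rw [Finset.prod_eq_single i]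
    · simp
    · intro j _ hj; simp [Pi.single_eq_of_ne hj]
    · simp
  rw [sqProd, this]
  rfl

/-- An endomorphism of `G_n` multiplying each exponent by a constant on the `x_i²` acts in the same
way on all of `A_n`. -/
lemma map_sqProd (f : G n →* G n) (c : Fin n → ℤ) (hf : ∀ i, f (x i ^ 2) = (x i ^ 2) ^ c i)
    (z : Fin n → ℤ) : f (sqProd z) = sqProd fun i => c i * z i := by
  have hA : ∀ a : A n, f a ∈ A n := by
    have : A n ≤ (A n).comap f := by
      conv_lhs => rw [A]
      rw [Subgroup.closure_le]
      rintro _ ⟨i, rfl⟩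
      simp only [SetLike.mem_coe, Subgroup.mem_comap, hf]
      exact zpow_mem (sq_mem i) _
    exact fun a => this a.2
  let g : A n →* A n := (f.comp (A n).subtype).codRestrict (A n) hA
  have hg : ∀ i, g (sq i) = sq i ^ c i := fun i => Subtype.ext (hf i)
  have : g (sqHom n (Multiplicative.ofAdd z)) =
      sqHom n (Multiplicative.ofAdd fun i => c i * z i) := by
    simp [sqHom, map_prod, hg, zpow_mul]
  exact congrArg Subtype.val this

lemma conj_sqProd (i : Fin n) (z : Fin n → ℤ) :
    (x i)⁻¹ * sqProd z * x i = sqProd fun j => (if j = i then 1 else -1) * z j := by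
  have := map_sqProd (MulAut.conj (x i)⁻¹).toMonoidHom (fun j => if j = i then 1 else -1)
    (fun j => ?_) z
  · simpa using this
  · have := conj_sq i j
    simp only [MulEquiv.toMonoidHom_eq_coe, MonoidHom.coe_coe, MulAut.conj_apply, inv_inv]
    rw [this]
    split_ifs <;> simp

/-- The action of `G_n` on `ℤ` in which `x_k` is the translation by `1` and every other generator is
the reflection `s ↦ -s`. It detects the exponent of `x_k²` in elements of `A_n`. -/
def coordHom (k : Fin n) : G n →* Equiv.Perm ℤ :=
  lift (fun i => if i = k then Equiv.addRight 1 else Equiv.neg ℤ) (by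
    intro i j hij
    by_cases hj : j = k
    · subst hj
      ext s
      simp only [if_neg hij, if_true, pow_two, mul_inv_rev, Equiv.Perm.mul_apply,
        Equiv.Perm.inv_def, Equiv.neg_symm, Equiv.neg_apply, Equiv.coe_addRight,
        Equiv.addRight_symm]
      ring
    · have : (Equiv.neg ℤ) ^ 2 = (1 : Equiv.Perm ℤ) := by
        ext s; simp [pow_two]
      simp only [hj, if_false, this, mul_one, inv_one, inv_mul_cancel])

lemma coordHom_sqProd (k : Fin n) (z : Fin n → ℤ) (s : ℤ) :
    coordHom k (sqProd z) s = s + 2 * z k := by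
  have h1 : ∀ i, coordHom k (x i ^ 2) = if i = k then Equiv.addRight (2 : ℤ) else 1 := by
    intro i
    rw [map_pow, coordHom, lift_x]
    split_ifs
    · ext s; simp [pow_two, add_assoc]
    · ext s; simp [pow_two]
  have h2 : z = ∑ i, Pi.single i (z i) := (Finset.univ_sum_single z).symm
  have h3 : ∀ (S : Finset (Fin n)) (s : ℤ),
      coordHom k (sqProd (∑ i ∈ S, Pi.single i (z i))) s = s + if k ∈ S then 2 * z k else 0 := by
    intro S
    induction S using Finset.induction_on with
    | empty => intro s; simp [sqProd]
    | insert i S hi ih =>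
      intro s
      rw [Finset.sum_insert hi, sqProd_add, map_mul, Equiv.Perm.mul_apply, ih, sqProd_single,
        map_zpow, h1]
      by_cases hik : i = k
      · subst hik
        simp [hi, mul_comm]
      · simp [hik, Ne.symm hik]
  rw [h2, h3]
  simp

lemma sqProd_injective : Function.Injective (sqProd : (Fin n → ℤ) → G n) := by
  intro y z h
  funext k
  have h1 := coordHom_sqProd k y 0
  rw [h, coordHom_sqProd] at h1
  omega

lemma sqHom_bijective (n : ℕ) : Function.Bijective (sqHom n) := by
  constructor
  · intro y z h
    exact sqProd_injective (congrArg Subtype.val h)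
  · rintro ⟨a, ha⟩
    have : A n ≤ (sqHom n).range.map (A n).subtype := by
      conv_lhs => rw [A]
      rw [Subgroup.closure_le]
      rintro _ ⟨i, rfl⟩
      exact ⟨_, ⟨Multiplicative.ofAdd (Pi.single i 1), rfl⟩, by
        simpa [sqProd] using sqProd_single i 1⟩
    obtain ⟨_, ⟨z, rfl⟩, hz⟩ := this ha
    exact ⟨z, Subtype.ext hz⟩

/-- `A_n` is free abelian with basis `x_1², …, x_n²`. -/
noncomputable def sqEquiv (n : ℕ) : Multiplicative (Fin n → ℤ) ≃* A n :=
  MulEquiv.ofBijective (sqHom n) (sqHom_bijective n)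

/-- The exponent vector `(a_1, …, a_n)` of `a = (x_1²)^{a_1} ⋯ (x_n²)^{a_n} ∈ A_n`. -/
noncomputable def expo (a : A n) : Fin n → ℤ := ((sqEquiv n).symm a).toAdd

lemma sqProd_expo (a : A n) : sqProd (expo a) = a :=
  congrArg Subtype.val ((sqEquiv n).apply_symm_apply a)

/-! ### Shift endomorphisms -/

/-- The set `M` of integral `n × n` matrices, to be endowed with the operation `*` below (which is
not the matrix product). -/
@[ext] structure M (n : ℕ) where
  /-- the underlying matrix -/
  entry : Matrix (Fin n) (Fin n) ℤ

/-- The monoid `(M, *)`: `(𝔞 * 𝔟)_{ij} = 𝔞_{ij} + (1 + 2 𝔞_{jj}) 𝔟_{ij}`, with the zero matrix as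
identity. -/
instance : Monoid (M n) where
  mul a b := ⟨fun i j => a.entry i j + (1 + 2 * a.entry j j) * b.entry i j⟩
  one := ⟨0⟩
  mul_assoc a b c := by
    ext i j
    change a.entry i j + (1 + 2 * a.entry j j) * b.entry i j +
        (1 + 2 * (a.entry j j + (1 + 2 * a.entry j j) * b.entry j j)) * c.entry i j =
      a.entry i j + (1 + 2 * a.entry j j) *
        (b.entry i j + (1 + 2 * b.entry j j) * c.entry i j)
    ring
  one_mul a := by
    ext i j
    change (0 : ℤ) + (1 + 2 * 0) * a.entry i j = a.entry i j
    ring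
  mul_one a := by
    ext i j
    change a.entry i j + (1 + 2 * a.entry j j) * 0 = a.entry i j
    ring

lemma M.mul_entry (a b : M n) (i j : Fin n) :
    (a * b).entry i j = a.entry i j + (1 + 2 * a.entry j j) * b.entry i j := rfl

lemma M.one_entry (i j : Fin n) : (1 : M n).entry i j = 0 := rfl

lemma sq_x_mul (i : Fin n) (z : Fin n → ℤ) :
    (x i * sqProd z) ^ 2 = (x i ^ 2) ^ (2 * z i + 1) := by
  have h : (x i * sqProd z) ^ 2 = x i ^ 2 * (((x i)⁻¹ * sqProd z * x i) * sqProd z) := by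
    simp only [pow_two, mul_assoc, mul_inv_cancel_left]
  have h2 : ((fun j => (if j = i then 1 else -1) * z j) + z : Fin n → ℤ)
      = Pi.single i (2 * z i) := by
    funext j
    by_cases hj : j = i
    · subst hj; simp; ring
    · simp [hj]
  rw [h, conj_sqProd, ← sqProd_add, h2, sqProd_single, add_comm, zpow_add, zpow_one]

/-- The shift endomorphism `t_𝔞` of `G_n`, given by `t_𝔞(x_i) = x_i (x_1²)^{𝔞_{i1}} ⋯ (x_n²)^{𝔞_{in}}`. -/
def shift (a : M n) : G n →* G n :=
  lift (fun i => x i * sqProd (a.entry i)) (by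
    intro i j hij
    have hc : ∀ b ∈ A n, (sqProd (a.entry i))⁻¹ * b * sqProd (a.entry i) = b := by
      intro b hb
      have : sqProd (a.entry i) * b = b * sqProd (a.entry i) :=
        congrArg Subtype.val (mul_comm (⟨_, sqProd_mem (a.entry i)⟩ : A n) ⟨b, hb⟩)
      rw [mul_assoc, ← this, inv_mul_cancel_left]
    have h1 : (x i)⁻¹ * (x j ^ 2) ^ (2 * a.entry j j + 1) * x i
        = ((x j ^ 2) ^ (2 * a.entry j j + 1))⁻¹ := by
      have := conj_zpow (a := (x i)⁻¹) (b := x j ^ 2) (i := 2 * a.entry j j + 1)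
      rw [inv_inv] at this
      rw [← this, x_rel hij, inv_zpow]
    rw [sq_x_mul]
    calc _ = (sqProd (a.entry i))⁻¹ * ((x i)⁻¹ * (x j ^ 2) ^ (2 * a.entry j j + 1) * x i) *
          sqProd (a.entry i) := by group
      _ = _ := by rw [h1, hc _ (inv_mem (zpow_mem (sq_mem j) _))])

@[simp] lemma shift_x (a : M n) (i : Fin n) : shift a (x i) = x i * sqProd (a.entry i) :=
  lift_x _ _ i

lemma shift_sqProd (a : M n) (z : Fin n → ℤ) :
    shift a (sqProd z) = sqProd fun j => (1 + 2 * a.entry j j) * z j :=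
  map_sqProd _ _ (fun i => by rw [map_pow, shift_x, sq_x_mul, add_comm]) z

/-- The homomorphism of monoids `t : M → End(G_n)`, `𝔞 ↦ t_𝔞`. -/
def shiftHom (n : ℕ) : M n →* Monoid.End (G n) where
  toFun := shift
  map_one' := hom_ext fun i => by
    rw [shift_x]
    change x i * sqProd 0 = x i
    simp [sqProd]
  map_mul' a b := hom_ext fun i => by
    change shift (a * b) (x i) = shift a (shift b (x i))
    rw [shift_x, shift_x, map_mul, shift_x, shift_sqProd, mul_assoc, ← sqProd_add]
    rfl

/-- The homomorphism `t : M* → Aut(G_n)`, `𝔞 ↦ t_𝔞`, on the group `M*` of units of `(M, *)`. -/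
def t (n : ℕ) : (M n)ˣ →* MulAut (G n) where
  toFun a :=
    { toFun := shift (a : M n)
      invFun := shift ((a⁻¹ : (M n)ˣ) : M n)
      left_inv := fun g => by
        have h := map_mul (shiftHom n) ((a⁻¹ : (M n)ˣ) : M n) (a : M n)
        rw [Units.inv_mul, map_one] at h
        exact (DFunLike.congr_fun h g).symm
      right_inv := fun g => by
        have h := map_mul (shiftHom n) (a : M n) ((a⁻¹ : (M n)ˣ) : M n)
        rw [Units.mul_inv, map_one] at h
        exact (DFunLike.congr_fun h g).symm
      map_mul' := map_mul _ }
  map_one' := MulEquiv.ext fun g => DFunLike.congr_fun (map_one (shiftHom n)) g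
  map_mul' a b := MulEquiv.ext fun g => DFunLike.congr_fun (map_mul (shiftHom n) (a : M n) (b : M n)) g

/-! ### The embedding of `A_n` into `M*` -/

/-- The matrix with zero diagonal and with entry `-2 z_j` at every off-diagonal place `(i, j)`. -/
def iotaM (z : Fin n → ℤ) : M n := ⟨fun i j => if i = j then 0 else -2 * z j⟩

lemma iotaM_add (y z : Fin n → ℤ) : iotaM (y + z) = iotaM y * iotaM z := by
  ext i j
  rw [M.mul_entry]
  by_cases h : i = j
  · simp [iotaM, h]
  · simp [iotaM, h]; ring

/-- `ι : A_n → M*`, sending `a = (x_1²)^{a_1} ⋯ (x_n²)^{a_n}` to the matrix with zero diagonal and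
with entry `-2 a_j` at every off-diagonal place `(i, j)`. -/
noncomputable def iota (n : ℕ) : A n →* (M n)ˣ :=
  MonoidHom.toHomUnits
    { toFun := fun a => iotaM (expo a)
      map_one' := by
        ext i j
        rw [M.one_entry]
        simp [iotaM, expo]
      map_mul' := fun a b => by
        rw [← iotaM_add]
        simp [expo] }

lemma iota_val (a : A n) : ((iota n a : (M n)ˣ) : M n) = iotaM (expo a) := rfl

lemma expo_sqHom (z : Fin n → ℤ) : expo (sqHom n (Multiplicative.ofAdd z)) = z :=
  congrArg Multiplicative.toAdd ((sqEquiv n).symm_apply_apply (Multiplicative.ofAdd z))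

instance : (iota n).range.Normal := by
  refine ⟨?_⟩
  rintro _ ⟨a, rfl⟩ g
  refine ⟨sqHom n (Multiplicative.ofAdd fun j => (1 + 2 * (g : M n).entry j j) * expo a j), ?_⟩
  rw [eq_mul_inv_iff_mul_eq]
  refine Units.ext ?_
  ext i j
  rw [Units.val_mul, Units.val_mul, M.mul_entry, M.mul_entry, iota_val, iota_val, expo_sqHom]
  by_cases h : i = j
  · simp [iotaM, h]
  · simp [iotaM, h]; ring

/-- `t_{ι(a)}` is the conjugation by `a`. -/
lemma t_iota (a : A n) : t n (iota n a) = MulAut.conj (a : G n) := by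
  have : (shift (iotaM (expo a)) : G n →* G n) = (MulAut.conj (a : G n)).toMonoidHom := by
    refine hom_ext fun i => ?_
    have h : (a : G n) * x i * (a : G n)⁻¹ =
        x i * (((x i)⁻¹ * sqProd (expo a) * x i) * sqProd (-expo a)) := by
      have h0 : sqProd (-expo a) = (a : G n)⁻¹ := by
        rw [eq_inv_iff_mul_eq_one]
        conv_lhs => rw [← sqProd_expo a]
        rw [← sqProd_add]
        simp [sqProd]
      rw [h0, sqProd_expo]; group
    change shift (iotaM (expo a)) (x i) = a * x i * (a : G n)⁻¹
    rw [shift_x, h, conj_sqProd, ← sqProd_add]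
    congr 2
    funext j
    by_cases hj : j = i
    · subst hj; simp [iotaM]
    · simp [iotaM, hj, Ne.symm hj]; ring
  exact MulEquiv.ext fun g => DFunLike.congr_fun this g

/-- The homomorphism `M*/ι(A_n) → Out(G_n)`, `𝔞 ι(A_n) ↦ t_𝔞 Inn(G_n)`. -/
noncomputable def tOut (n : ℕ) : (M n)ˣ ⧸ (iota n).range →* Out (G n) :=
  QuotientGroup.map (iota n).range (Inn (G n)) (t n) (by
    rintro _ ⟨a, rfl⟩
    exact ⟨a, (t_iota a).symm⟩)

end HantzscheWendt

namespace HantzscheWendt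

variable {n : ℕ}

/-! ### Reduced words in `W_n` -/

/-! Modulo the squares the relations of G disappear, so W is the free product of n copies of ℤ/2,
and elements of W have unique reduced words (`wordProd_injOn`, `exists_reduced_word`). Three facts
about W carry the proof: for n ≥ 3 a nontrivial element fails to commute with some conjugate
(`eq_one_of_commute_conj`); involutions are conjugate to generators (`exists_conj_gen`); distinct
generators are not conjugate (`gen_conj_inj`).

The first fact makes A characteristic, since A is abelian and normal, and makes the centre of W
trivial.

For the middle row, an automorphism trivial on W moves each x_i within its coset of A, so it and its
inverse are shifts (`exists_t_eq`). By the other two facts, an automorphism ψ of W sends generators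
to conjugates of distinct generators. The same formula on the x_i defines an endomorphism of G,
because every element of G conjugates x_k² to itself or its inverse (`exists_hom_lift`). Lifts of ψ
and ψ⁻¹ compose to shifts that are bijective (`comp_bijective`), so the lift of ψ is an
automorphism.

The bottom row and the columns follow by chasing the diagram, using that W has trivial centre and
that `iota` is injective. -/

/-- The image of `x_i` in `W_n`. -/
def gen (i : Fin n) : W n := (x i : G n)

lemma gen_mul_self (i : Fin n) : gen i * gen i = 1 := by
  have := (QuotientGroup.eq_one_iff (x i ^ 2)).2 (sq_mem i)
  rwa [pow_two] at this

lemma gen_inv (i : Fin n) : (gen i)⁻¹ = gen i := inv_eq_of_mul_eq_one_left (gen_mul_self i)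

/-- The words in `Fin n` without two equal consecutive letters. -/
abbrev RedWord (n : ℕ) : Type := {l : List (Fin n) // l.IsChain (· ≠ ·)}

/-- The reduced form of the word obtained by putting the letter `i` before a reduced word. -/
def pushList (i : Fin n) : List (Fin n) → List (Fin n)
  | [] => [i]
  | j :: l => if i = j then l else i :: j :: l

lemma isChain_pushList (i : Fin n) {l : List (Fin n)} (hl : l.IsChain (· ≠ ·)) :
    (pushList i l).IsChain (· ≠ ·) := by
  cases l with
  | nil => simp [pushList]
  | cons j l =>
    rw [pushList]
    split_ifs with h
    · exact hl.tail
    · exact List.isChain_cons_cons.2 ⟨h, hl⟩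

lemma pushList_of_isChain {i : Fin n} {l : List (Fin n)} (hl : (i :: l).IsChain (· ≠ ·)) :
    pushList i l = i :: l := by
  cases l with
  | nil => rfl
  | cons j l => exact if_neg (List.isChain_cons_cons.1 hl).1

lemma pushList_pushList (i : Fin n) {l : List (Fin n)} (hl : l.IsChain (· ≠ ·)) :
    pushList i (pushList i l) = l := by
  cases l with
  | nil => simp [pushList]
  | cons j l =>
    by_cases h : i = j
    · subst h
      rw [pushList, if_pos rfl, pushList_of_isChain hl]
    · rw [pushList, if_neg h, pushList, if_pos rfl]

/-- The permutation of the reduced words given by multiplication by the letter `i`. -/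
def push (i : Fin n) : Equiv.Perm (RedWord n) :=
  Function.Involutive.toPerm (fun l => ⟨pushList i l.1, isChain_pushList i l.2⟩)
    fun l => Subtype.ext (pushList_pushList i l.2)

lemma push_val (i : Fin n) (l : RedWord n) : (push i l).1 = pushList i l.1 := rfl

lemma push_sq (i : Fin n) : push i ^ 2 = 1 := by
  ext1 l
  exact Subtype.ext (pushList_pushList i l.2)

/-- The action of `G_n` on the reduced words. -/
def wordActG (n : ℕ) : G n →* Equiv.Perm (RedWord n) :=
  lift push fun i j _ => by simp [push_sq]

/-- The action of `W_n` on the reduced words. -/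
def wordAct (n : ℕ) : W n →* Equiv.Perm (RedWord n) :=
  QuotientGroup.lift (A n) (wordActG n) (by
    rw [A, Subgroup.closure_le]
    rintro _ ⟨i, rfl⟩
    change wordActG n (x i ^ 2) = 1
    rw [map_pow, wordActG, lift_x, push_sq])

lemma wordAct_gen (i : Fin n) : wordAct n (gen i) = push i := by
  change wordActG n (x i) = push i
  rw [wordActG, lift_x]

/-- The element of `W_n` represented by a word. -/
def wordProd (l : List (Fin n)) : W n := (l.map gen).prod

lemma wordProd_cons (i : Fin n) (l : List (Fin n)) :
    wordProd (i :: l) = gen i * wordProd l := List.prod_cons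

lemma wordProd_append (l m : List (Fin n)) :
    wordProd (l ++ m) = wordProd l * wordProd m := by
  simp [wordProd]

lemma wordProd_singleton (i : Fin n) : wordProd [i] = gen i := by simp [wordProd]

lemma wordProd_reverse (l : List (Fin n)) : wordProd l.reverse = (wordProd l)⁻¹ := by
  induction l with
  | nil => simp [wordProd]
  | cons i l ih =>
    rw [List.reverse_cons, wordProd_append, ih, wordProd_singleton, wordProd_cons, mul_inv_rev,
      gen_inv]

lemma wordProd_pushList (i : Fin n) (l : List (Fin n)) :
    wordProd (pushList i l) = gen i * wordProd l := by
  cases l with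
  | nil => rfl
  | cons j l =>
    rw [pushList]
    split_ifs with h
    · subst h
      rw [wordProd_cons, ← mul_assoc, gen_mul_self, one_mul]
    · rw [wordProd_cons]

lemma G_induction {p : G n → Prop} (hx : ∀ i, p (x i)) (one : p 1)
    (mul : ∀ g h, p g → p h → p (g * h)) (inv : ∀ g, p g → p g⁻¹) (g : G n) : p g := by
  have hg : g ∈ Subgroup.closure (Set.range (PresentedGroup.of : Fin n → G n)) := by
    rw [PresentedGroup.closure_range_of]; trivial
  refine Subgroup.closure_induction (p := fun g _ => p g) ?_ one (fun g h _ _ => mul g h)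
    (fun g _ => inv g) hg
  rintro _ ⟨i, rfl⟩
  exact hx i

/-- Applied to the empty word, this shows that every element of W has a reduced word. -/
lemma wordProd_wordAct (w : W n) (l : RedWord n) :
    wordProd (wordAct n w l).1 = w * wordProd l.1 := by
  obtain ⟨g, rfl⟩ := QuotientGroup.mk_surjective w
  induction g using G_induction generalizing l with
  | hx i =>
    change wordProd (wordAct n (gen i) l).1 = gen i * _
    rw [wordAct_gen, push_val, wordProd_pushList]
  | one => simp
  | mul g h hg hh =>
    rw [QuotientGroup.mk_mul, map_mul, Equiv.Perm.mul_apply, hg, hh, mul_assoc]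
  | inv g hg =>
    have := hg ((wordAct n (g : W n)).symm l)
    rw [Equiv.apply_symm_apply] at this
    rw [this, QuotientGroup.mk_inv, map_inv, inv_mul_cancel_left]
    rfl

/-- Building a reduced word letter by letter never triggers a cancellation. The word is thus
recovered from its product, which gives uniqueness of reduced forms. -/
lemma wordAct_wordProd {l : List (Fin n)} (hl : l.IsChain (· ≠ ·)) :
    wordAct n (wordProd l) ⟨[], List.isChain_nil⟩ = ⟨l, hl⟩ := by
  induction l with
  | nil => simp [wordProd]
  | cons i l ih =>
    rw [wordProd_cons, map_mul, Equiv.Perm.mul_apply, ih hl.tail, wordAct_gen]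
    exact Subtype.ext (pushList_of_isChain hl)

lemma wordProd_injOn {l m : List (Fin n)} (hl : l.IsChain (· ≠ ·)) (hm : m.IsChain (· ≠ ·))
    (h : wordProd l = wordProd m) : l = m := by
  have h1 := wordAct_wordProd hl
  rw [h, wordAct_wordProd hm] at h1
  exact (congrArg Subtype.val h1).symm

lemma exists_reduced_word (w : W n) :
    ∃ l : List (Fin n), l.IsChain (· ≠ ·) ∧ wordProd l = w := by
  refine ⟨(wordAct n w ⟨[], List.isChain_nil⟩).1, (wordAct n w ⟨[], List.isChain_nil⟩).2, ?_⟩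
  rw [wordProd_wordAct]
  simp [wordProd]

lemma gen_ne_one (i : Fin n) : gen i ≠ 1 := fun h => by
  have := wordProd_injOn (l := [i]) (m := []) (List.isChain_singleton i) List.isChain_nil
    (by rw [wordProd_singleton, h]; rfl)
  simp at this

/-- If `n ≥ 3`, then a nontrivial element of `W_n` does not commute with all of its conjugates. -/
lemma eq_one_of_commute_conj (hn : 3 ≤ n) {w : W n} (h : ∀ g, Commute w (g * w * g⁻¹)) :
    w = 1 := by
  obtain ⟨l, hl, rfl⟩ := exists_reduced_word w
  by_contra hw
  have hne : l ≠ [] := by rintro rfl; exact hw rfl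
  -- With three letters available, some c differs from both ends of l. Then l c l c and c l c l are
  -- both reduced. If w commuted with c w c⁻¹ they would represent the same element, yet their first
  -- letters differ.
  obtain ⟨c, hc⟩ : ∃ c : Fin n, c ∉ ({l.head hne, l.getLast hne} : Finset (Fin n)) := by
    by_contra! hall
    have h1 := Finset.card_le_card (fun c _ => hall c :
      (Finset.univ : Finset (Fin n)) ⊆ {l.head hne, l.getLast hne})
    have h2 := Finset.card_le_two (a := l.head hne) (b := l.getLast hne)
    rw [Finset.card_univ, Fintype.card_fin] at h1
    omega
  simp only [Finset.mem_insert, Finset.mem_singleton, not_or] at hc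
  have e1 : (c :: l).IsChain (· ≠ ·) := by
    rw [List.isChain_cons]
    refine ⟨fun y hy => ?_, hl⟩
    rw [List.head?_eq_some_head hne, Option.mem_some_iff] at hy
    exact hy ▸ hc.1
  have e2 : (l ++ [c]).IsChain (· ≠ ·) := by
    rw [List.isChain_append]
    refine ⟨hl, List.isChain_singleton c, fun y hy z hz => ?_⟩
    rw [List.getLast?_eq_some_getLast hne, Option.mem_some_iff] at hy
    simp only [List.head?_cons, Option.mem_some_iff] at hz
    subst hy hz
    exact Ne.symm hc.2
  have glue : ∀ {u v : List (Fin n)}, (u ++ [c]).IsChain (· ≠ ·) → (c :: v).IsChain (· ≠ ·) →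
      (u ++ c :: v).IsChain (· ≠ ·) := fun hu hv => by
    exact List.isChain_split.2 ⟨hu, hv⟩
  have e3 : (c :: l ++ c :: l).IsChain (· ≠ ·) := by
    refine glue ?_ e1
    rw [List.cons_append, List.isChain_cons]
    refine ⟨fun y hy => ?_, e2⟩
    rw [List.head?_append_of_ne_nil _ hne, List.head?_eq_some_head hne, Option.mem_some_iff] at hy
    exact hy ▸ hc.1
  have e4 : (l ++ c :: (l ++ [c])).IsChain (· ≠ ·) := by
    refine glue e2 ?_
    rw [List.isChain_cons]
    refine ⟨fun y hy => ?_, e2⟩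
    rw [List.head?_append_of_ne_nil _ hne, List.head?_eq_some_head hne, Option.mem_some_iff] at hy
    exact hy ▸ hc.1
  have key := wordProd_injOn e4 e3 (by
    have := h (gen c)
    rw [gen_inv] at this
    simp only [List.cons_append, wordProd_append, wordProd_cons]
    simpa only [mul_assoc, wordProd, List.map_nil, List.prod_nil, mul_one] using this.eq)
  have h1 := congrArg List.head? key
  rw [List.head?_append_of_ne_nil _ hne, List.head?_eq_some_head hne] at h1
  simp only [List.cons_append, List.head?_cons, Option.some.injEq] at h1
  exact hc.1 h1.symm

/-- An involution of `W_n` is conjugate to a generator. -/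
lemma exists_conj_gen {w : W n} (hw : w * w = 1) (hw1 : w ≠ 1) :
    ∃ g i, w = g * gen i * g⁻¹ := by
  obtain ⟨l, hl, rfl⟩ := exists_reduced_word w
  -- An involution equals its inverse, which is represented by the reversed word. That word is again
  -- reduced, so uniqueness makes l a palindrome; peeling off equal outer letters is conjugation by
  -- a generator.
  have hrev : l.reverse = l := by
    refine wordProd_injOn ?_ hl ?_
    · rw [List.isChain_reverse]
      exact hl.imp fun _ _ => Ne.symm
    · rw [wordProd_reverse]
      exact inv_eq_of_mul_eq_one_left hw
  have hp := List.Palindrome.of_reverse_eq hrev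
  clear hrev hw
  induction hp with
  | nil => exact absurd rfl hw1
  | singleton i => exact ⟨1, i, by simp [wordProd_singleton]⟩
  | @cons_concat i l _ ih =>
    -- An empty middle would leave the unreduced word i i.
    have hne : l ≠ [] := by rintro rfl; simp at hl
    have hl' : l.IsChain (· ≠ ·) := (List.isChain_append.1 hl.tail).1
    obtain ⟨g, j, hg⟩ := ih hl' fun h => hne
      (wordProd_injOn hl' List.isChain_nil (h.trans rfl))
    refine ⟨gen i * g, j, ?_⟩
    rw [wordProd_cons, wordProd_append, wordProd_singleton, hg, mul_inv_rev, gen_inv]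
    simp only [mul_assoc]

/-- Distinct generators of `W_n` are not conjugate. -/
lemma gen_conj_inj {i j : Fin n} {g : W n} (h : gen i = g * gen j * g⁻¹) : i = j := by
  by_contra hij
  -- The parity of the number of occurrences of the letter i is a homomorphism to an abelian group,
  -- hence constant on conjugacy classes.
  let q : G n →* Multiplicative (ZMod 2) :=
    lift (fun k => if k = i then Multiplicative.ofAdd 1 else 1) fun k m _ => by
      split_ifs <;> decide
  have hq : A n ≤ q.ker := by
    rw [A, Subgroup.closure_le]
    rintro _ ⟨k, rfl⟩
    change q (x k ^ 2) = 1
    rw [map_pow, lift_x]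
    split_ifs <;> decide
  have h1 := congrArg (QuotientGroup.lift (A n) q hq) h
  rw [map_mul, map_mul, map_inv, mul_right_comm, mul_inv_cancel, one_mul] at h1
  change q (x i) = q (x j) at h1
  rw [lift_x, lift_x, if_pos rfl, if_neg (Ne.symm hij)] at h1
  exact absurd h1 (by decide)

/-! ### Consequences for `G_n` -/

/-- The image of φ(A) in W is an abelian normal subgroup, so each of its elements commutes with all
its conjugates and is trivial. -/
lemma A_characteristic (hn : 3 ≤ n) : (A n).Characteristic := by
  rw [Subgroup.characteristic_iff_map_le]
  rintro φ _ ⟨a, ha, rfl⟩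
  refine (QuotientGroup.eq_one_iff _).1 (eq_one_of_commute_conj hn fun w => ?_)
  obtain ⟨g, rfl⟩ := QuotientGroup.mk_surjective w
  have hc : a * (φ.symm g * a * (φ.symm g)⁻¹) = φ.symm g * a * (φ.symm g)⁻¹ * a :=
    congrArg Subtype.val (mul_comm (⟨a, ha⟩ : A n)
      ⟨_, (inferInstance : (A n).Normal).conj_mem a ha (φ.symm g)⟩)
  have h := congrArg (fun y => (φ y : W n)) hc
  simpa [Commute, SemiconjBy] using h

/-- A central element equals all its conjugates, and so commutes with them. -/
lemma conj_W_injective (hn : 3 ≤ n) :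
    Function.Injective (MulAut.conj : W n →* MulAut (W n)) := by
  rw [injective_iff_map_eq_one]
  intro w hw
  refine eq_one_of_commute_conj hn fun g => ?_
  have h : w * g * w⁻¹ = g := DFunLike.congr_fun hw g
  rw [← mul_inv_eq_iff_eq_mul.1 h, mul_inv_cancel_right]

lemma iota_injective (hn : 2 ≤ n) : Function.Injective (iota n) := by
  rw [injective_iff_map_eq_one]
  intro a ha
  have hz : expo a = 0 := by
    funext j
    have : Nontrivial (Fin n) := Fin.nontrivial_iff_two_le.2 hn
    -- The exponent of x_j² is visible only off the diagonal of column j, so a second index is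
    -- needed.
    obtain ⟨i, hij⟩ := exists_ne j
    have h := congrArg (fun u : (M n)ˣ => (u : M n).entry i j) ha
    simp only [iota_val, iotaM, if_neg hij, Units.val_one, M.one_entry] at h
    simpa using h
  have h := sqProd_expo a
  rw [hz] at h
  exact Subtype.ext (h.symm.trans (by simp [sqProd]))

lemma shift_injective : Function.Injective (shift : M n → G n →* G n) := by
  intro a b h
  ext i j
  have h1 := DFunLike.congr_fun h (x i)
  rw [shift_x, shift_x] at h1
  exact congrFun (sqProd_injective (mul_left_cancel h1)) j

lemma shift_mul (a b : M n) : shift (a * b) = (shift a).comp (shift b) :=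
  map_mul (shiftHom n) a b

lemma shift_one : shift (1 : M n) = MonoidHom.id (G n) := map_one (shiftHom n)

lemma t_injective (n : ℕ) : Function.Injective (t n) := fun _ _ h =>
  Units.ext (shift_injective (MonoidHom.ext fun g => DFunLike.congr_fun h g))

lemma exists_sqProd_eq {g : G n} (hg : g ∈ A n) : ∃ z, sqProd z = g :=
  ⟨expo ⟨g, hg⟩, sqProd_expo ⟨g, hg⟩⟩

/-- The shift endomorphisms are those inducing the identity on `W_n`. -/
lemma exists_shift_eq (f : G n →* G n) (hf : ∀ i, ((f (x i) : G n) : W n) = gen i) :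
    ∃ a, shift a = f := by
  have h : ∀ i, ∃ z, sqProd z = (x i)⁻¹ * f (x i) := fun i =>
    exists_sqProd_eq (QuotientGroup.eq.1 (hf i).symm)
  choose z hz using h
  refine ⟨⟨z⟩, hom_ext fun i => ?_⟩
  rw [shift_x]
  change x i * sqProd (z i) = _
  rw [hz, mul_inv_cancel_left]

/-- Both f and its inverse are shifts; since `shift` is injective, their matrices are mutually
inverse in M. -/
lemma exists_t_eq (f : MulAut (G n)) (hf : ∀ g, ((f g : G n) : W n) = g) : ∃ a, t n a = f := by
  obtain ⟨a, ha⟩ := exists_shift_eq f.toMonoidHom fun i => hf (x i)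
  obtain ⟨b, hb⟩ := exists_shift_eq f.symm.toMonoidHom fun i => by
    have := hf (f.symm (x i))
    rw [MulEquiv.apply_symm_apply] at this
    exact this.symm
  have hab : a * b = 1 := shift_injective <| by
    rw [shift_mul, ha, hb, shift_one]
    exact MonoidHom.ext fun g => f.apply_symm_apply g
  have hba : b * a = 1 := shift_injective <| by
    rw [shift_mul, ha, hb, shift_one]
    exact MonoidHom.ext fun g => f.symm_apply_apply g
  exact ⟨⟨a, b, hab, hba⟩, MulEquiv.ext fun g => DFunLike.congr_fun ha g⟩

lemma shift_bijective {a : M n} (ha : ∀ j, (1 + 2 * a.entry j j) ^ 2 = 1) :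
    Function.Bijective (shift a) := by
  -- Solving a * b = 1 entrywise requires dividing by 1 + 2a_jj, which by `ha` is its own inverse.
  let b : M n := ⟨fun i j => -((1 + 2 * a.entry j j) * a.entry i j)⟩
  have hab : a * b = 1 := by
    ext i j
    rw [M.mul_entry, M.one_entry]
    linear_combination -a.entry i j * ha j
  have hba : b * a = 1 := by
    ext i j
    rw [M.mul_entry, M.one_entry]
    change -((1 + 2 * a.entry j j) * a.entry i j) +
      (1 + 2 * -((1 + 2 * a.entry j j) * a.entry j j)) * a.entry i j = 0
    linear_combination -a.entry i j * ha j
  refine Function.bijective_iff_has_inverse.2 ⟨shift b, fun g => ?_, fun g => ?_⟩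
  · have := shift_mul b a
    rw [hba, shift_one] at this
    exact (DFunLike.congr_fun this g).symm
  · have := shift_mul a b
    rw [hab, shift_one] at this
    exact (DFunLike.congr_fun this g).symm

/-! ### Lifting automorphisms of `W_n` -/

lemma inv_conj_of_conj_eq {H : Type*} [Group H] {g a b : H} (h : g * a * g⁻¹ = b) :
    g⁻¹ * b * g = a := by
  rw [← h]; group

lemma inv_conj_inv {H : Type*} [Group H] {g a : H} (h : g⁻¹ * a * g = a⁻¹) :
    g⁻¹ * a⁻¹ * g = a := by
  simpa [mul_assoc] using congrArg (·⁻¹) h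

/-- Each generator acts on x_k² by a sign, and signs multiply. -/
lemma conj_sq_or_inv (g : G n) (k : Fin n) :
    g * x k ^ 2 * g⁻¹ = x k ^ 2 ∨ g * x k ^ 2 * g⁻¹ = (x k ^ 2)⁻¹ := by
  induction g using G_induction with
  | hx i => rw [conj_sq']; split_ifs <;> simp
  | one => simp
  | mul g h hg hh =>
    have e : g * h * x k ^ 2 * (g * h)⁻¹ = g * (h * x k ^ 2 * h⁻¹) * g⁻¹ := by group
    rw [e]
    rcases hh with hh | hh
    · rwa [hh]
    · rw [hh, ← conj_inv]
      rcases hg with hg | hg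
      · exact Or.inr (by rw [hg])
      · exact Or.inl (by rw [hg, inv_inv])
  | inv g hg =>
    rcases hg with hg | hg
    · exact Or.inl (by rw [inv_inv]; exact inv_conj_of_conj_eq hg)
    · refine Or.inr ?_
      rw [← inv_inj, conj_inv, inv_inv, inv_inv]
      exact inv_conj_of_conj_eq hg

/-- The sign by which an element acts on x_k² is a homomorphism to an abelian group, so a conjugate
of x_i acts with the same sign as x_i. -/
lemma conj_x_conj_sq {i k : Fin n} (h : i ≠ k) (g : G n) :
    (g * x i * g⁻¹)⁻¹ * x k ^ 2 * (g * x i * g⁻¹) = (x k ^ 2)⁻¹ := by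
  have e : (g * x i * g⁻¹)⁻¹ * x k ^ 2 * (g * x i * g⁻¹) =
      g * ((x i)⁻¹ * (g⁻¹ * x k ^ 2 * g⁻¹⁻¹) * x i) * g⁻¹ := by group
  rw [e]
  have h1 := x_rel h
  rcases conj_sq_or_inv g⁻¹ k with h2 | h2
  · have h3 := inv_conj_of_conj_eq h2
    rw [inv_inv] at h3
    rw [h2, h1, ← conj_inv, h3]
  · have h3 := inv_conj_of_conj_eq h2
    rw [inv_inv] at h3
    rw [h2, inv_conj_inv h1, ← inv_inj, conj_inv, inv_inv, h3]

/-- Every automorphism of `W_n` is induced by an endomorphism of `G_n` that permutes the cyclic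
groups generated by the `x_i²`. -/
lemma exists_hom_lift (ψ : MulAut (W n)) :
    ∃ f : G n →* G n, (∀ g : G n, ((f g : G n) : W n) = ψ (g : W n)) ∧
      ∀ i, ∃ k, f (x i ^ 2) = x k ^ 2 ∨ f (x i ^ 2) = (x k ^ 2)⁻¹ := by
  have h : ∀ i, ∃ (g : G n) (k : Fin n), ψ (gen i) = (g : W n) * gen k * (g : W n)⁻¹ := by
    intro i
    obtain ⟨w, k, hw⟩ := exists_conj_gen (w := ψ (gen i))
      (by rw [← map_mul, gen_mul_self, map_one])
      (fun h => gen_ne_one i (ψ.injective (h.trans (map_one ψ).symm)))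
    obtain ⟨g, rfl⟩ := QuotientGroup.mk_surjective w
    exact ⟨g, k, hw⟩
  choose g σ hσ using h
  -- If σ i = σ j, then ψ(gen i) and ψ(gen j) are conjugate; pulling back by ψ, so are gen i and gen
  -- j.
  have hinj : Function.Injective σ := by
    intro i j hij
    have h1 : ψ (gen i) = (g i * (g j)⁻¹ : W n) * ψ (gen j) * (g i * (g j)⁻¹ : W n)⁻¹ := by
      rw [hσ, hσ, hij]
      simp only [QuotientGroup.mk_inv, mul_inv_rev, inv_inv, mul_assoc, inv_mul_cancel_left]
    refine gen_conj_inj (g := ψ.symm (g i * (g j)⁻¹ : W n)) (ψ.injective ?_)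
    rw [map_mul, map_mul, map_inv, MulEquiv.apply_symm_apply]
    exact h1
  have hsq : ∀ i, (g i * x (σ i) * (g i)⁻¹) ^ 2 = g i * x (σ i) ^ 2 * (g i)⁻¹ := fun i =>
    conj_pow
  -- The square of the j-th image is the square of x_{σ j} or its inverse, and the i-th image
  -- inverts it because σ i ≠ σ j.
  let f : G n →* G n := lift (fun i => g i * x (σ i) * (g i)⁻¹) fun i j hij => by
    have hk := conj_x_conj_sq (fun h => hij (hinj h)) (g i) (i := σ i) (k := σ j)
    rw [hsq]
    rcases conj_sq_or_inv (g j) (σ j) with h | h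
    · rw [h, hk]
    · rw [h, inv_conj_inv hk, inv_inv]
  have hf : ∀ i, f (x i) = g i * x (σ i) * (g i)⁻¹ := fun i => lift_x _ _ i
  refine ⟨f, fun y => ?_, fun i => ⟨σ i, ?_⟩⟩
  · have : (QuotientGroup.mk' (A n)).comp f = ψ.toMonoidHom.comp (QuotientGroup.mk' (A n)) :=
      hom_ext fun i => by
        rw [MonoidHom.comp_apply, hf]
        exact (hσ i).symm
    exact DFunLike.congr_fun this y
  · rw [map_pow, hf, hsq]
    exact conj_sq_or_inv _ _

/-- The composite induces the identity on W, so it is a shift, multiplying the exponent of x_j² by 1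
+ 2a_jj. It also sends x_j² to some x_k² or its inverse, which forces this factor to be ±1. -/
lemma comp_bijective {f f' : G n →* G n}
    (h : ∀ i, ((f (f' (x i)) : G n) : W n) = gen i)
    (hf : ∀ i, ∃ k, f (x i ^ 2) = x k ^ 2 ∨ f (x i ^ 2) = (x k ^ 2)⁻¹)
    (hf' : ∀ i, ∃ k, f' (x i ^ 2) = x k ^ 2 ∨ f' (x i ^ 2) = (x k ^ 2)⁻¹) :
    Function.Bijective (f ∘ f') := by
  obtain ⟨a, ha⟩ := exists_shift_eq (f.comp f') h
  have key : ∀ j, (1 + 2 * a.entry j j) ^ 2 = 1 := by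
    intro j
    have h1 : f (f' (x j ^ 2)) = sqProd (Pi.single j (2 * a.entry j j + 1)) := by
      rw [sqProd_single, ← sq_x_mul, ← shift_x, ← map_pow, ha]
      rfl
    have h2 : ∃ k, f (f' (x j ^ 2)) = x k ^ 2 ∨ f (f' (x j ^ 2)) = (x k ^ 2)⁻¹ := by
      obtain ⟨m, hm⟩ := hf' j
      obtain ⟨k, hk⟩ := hf m
      refine ⟨k, ?_⟩
      rcases hm with hm | hm
      · rwa [hm]
      · rw [hm, map_inv, inv_inj, inv_eq_iff_eq_inv]
        exact hk.symm
    obtain ⟨k, hk⟩ := h2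
    obtain ⟨e, he, hk⟩ : ∃ e : ℤ, (e = 1 ∨ e = -1) ∧ f (f' (x j ^ 2)) = sqProd (Pi.single k e) := by
      rcases hk with hk | hk
      · exact ⟨1, Or.inl rfl, by rw [sqProd_single, zpow_one, hk]⟩
      · exact ⟨-1, Or.inr rfl, by rw [sqProd_single, zpow_neg_one, hk]⟩
    have h3 := congrFun (sqProd_injective (h1.symm.trans hk)) j
    rw [Pi.single_eq_same] at h3
    by_cases hjk : j = k
    · subst hjk
      rw [Pi.single_eq_same] at h3
      rw [add_comm, h3]
      rcases he with rfl | rfl <;> norm_num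
    -- For k ≠ j the odd number 2a_jj + 1 would have to vanish.
    · rw [Pi.single_eq_of_ne hjk] at h3
      omega
  have := shift_bijective key
  rwa [ha] at this

lemma autQuot_surjective (hA : (A n).Characteristic) :
    Function.Surjective (autQuot (A n) hA) := by
  intro ψ
  obtain ⟨f, hf, hf2⟩ := exists_hom_lift ψ
  obtain ⟨f', hf', hf2'⟩ := exists_hom_lift ψ⁻¹
  have h1 := comp_bijective (f := f) (f' := f')
    (fun i => by rw [hf, hf']; exact ψ.apply_symm_apply _) hf2 hf2'
  have h2 := comp_bijective (f := f') (f' := f)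
    (fun i => by rw [hf', hf]; exact ψ.symm_apply_apply _) hf2' hf2
  -- Injectivity of f comes from f' ∘ f and surjectivity from f ∘ f'.
  refine ⟨MulEquiv.ofBijective f ⟨h2.injective.of_comp, h1.surjective.of_comp⟩,
    MulEquiv.ext fun w => ?_⟩
  obtain ⟨g, rfl⟩ := QuotientGroup.mk_surjective w
  exact hf g

/-! ### Exactness of the diagram -/

lemma autQuot_t (hA : (A n).Characteristic) (a : (M n)ˣ) : autQuot (A n) hA (t n a) = 1 := by
  have : (QuotientGroup.mk' (A n)).comp (shift (a : M n)) = QuotientGroup.mk' (A n) :=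
    hom_ext fun i => by
      rw [MonoidHom.comp_apply, shift_x, map_mul]
      exact mul_eq_left.2 ((QuotientGroup.eq_one_iff _).2 (sqProd_mem _))
  refine MulEquiv.ext fun w => ?_
  obtain ⟨g, rfl⟩ := QuotientGroup.mk_surjective w
  exact DFunLike.congr_fun this g

lemma range_t (hA : (A n).Characteristic) : (t n).range = (autQuot (A n) hA).ker := by
  ext f
  constructor
  · rintro ⟨a, rfl⟩
    exact autQuot_t hA a
  · intro hf
    exact exists_t_eq f fun g => DFunLike.congr_fun (MonoidHom.mem_ker.1 hf) (g : W n)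

/-- An element of `M*` acting as an inner automorphism lies in `ι(A_n)`. -/
lemma mem_range_iota (hn : 3 ≤ n) {a : (M n)ˣ} (ha : t n a ∈ Inn (G n)) :
    a ∈ (iota n).range := by
  obtain ⟨g, hg⟩ := ha
  have hA := A_characteristic hn
  have h := autQuot_t hA a
  rw [← hg, autQuot_conj] at h
  -- Shifts are trivial on W, so the image of g is central in W and hence trivial.
  have hgA : g ∈ A n := (QuotientGroup.eq_one_iff g).1
    (conj_W_injective hn (h.trans (map_one _).symm))
  exact ⟨⟨g, hgA⟩, t_injective n ((t_iota ⟨g, hgA⟩).trans hg)⟩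

/-- A central element of G has central, hence trivial, image in W, so it lies in A; on A conjugation
is `t` after `iota`, and both are injective. -/
lemma conj_G_injective (hn : 3 ≤ n) :
    Function.Injective (MulAut.conj : G n →* MulAut (G n)) := by
  rw [injective_iff_map_eq_one]
  intro g hg
  have h : MulAut.conj (g : W n) = 1 := by
    rw [← autQuot_conj (A n) (A_characteristic hn) g, hg, map_one]
  have hgA : g ∈ A n := (QuotientGroup.eq_one_iff g).1
    (conj_W_injective hn (h.trans (map_one _).symm))
  have h1 : iota n ⟨g, hgA⟩ = iota n 1 := t_injective n <| by
    rw [t_iota, map_one, map_one]; exact hg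
  exact congrArg Subtype.val (iota_injective (by omega) h1)

lemma tOut_injective (hn : 3 ≤ n) : Function.Injective (tOut n) := by
  rw [injective_iff_map_eq_one]
  intro y hy
  obtain ⟨a, rfl⟩ := QuotientGroup.mk_surjective y
  exact (QuotientGroup.eq_one_iff a).2
    (mem_range_iota hn ((QuotientGroup.eq_one_iff (t n a)).1 hy))

lemma range_tOut (hA : (A n).Characteristic) :
    (tOut n).range = (outQuot (A n) hA).ker := by
  ext y
  constructor
  · rintro ⟨a, rfl⟩
    obtain ⟨a, rfl⟩ := QuotientGroup.mk_surjective a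
    change ((autQuot (A n) hA (t n a) : MulAut (W n)) : Out (W n)) = 1
    rw [autQuot_t]
    rfl
  · intro hy
    obtain ⟨f, rfl⟩ := QuotientGroup.mk_surjective y
    obtain ⟨w, hw⟩ := (QuotientGroup.eq_one_iff (autQuot (A n) hA f)).1 hy
    obtain ⟨g, rfl⟩ := QuotientGroup.mk_surjective w
    -- f induces an inner automorphism of W; dividing by conjugation by a lift g leaves the class in
    -- Out(G) unchanged and gives an automorphism trivial on W, hence a shift.
    have hk : f * (MulAut.conj g)⁻¹ ∈ (autQuot (A n) hA).ker := by
      rw [MonoidHom.mem_ker, map_mul, map_inv, autQuot_conj, mul_inv_eq_one]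
      exact hw.symm
    rw [← range_t hA] at hk
    obtain ⟨a, ha⟩ := hk
    refine ⟨(a : (M n)ˣ ⧸ (iota n).range), ?_⟩
    change ((t n a : MulAut (G n)) : Out (G n)) = f
    rw [ha, QuotientGroup.mk_mul, mul_eq_left]
    exact (QuotientGroup.eq_one_iff _).2 (inv_mem ⟨g, rfl⟩)

lemma outQuot_surjective (hA : (A n).Characteristic) :
    Function.Surjective (outQuot (A n) hA) := by
  intro y
  obtain ⟨ψ, rfl⟩ := QuotientGroup.mk_surjective y
  obtain ⟨f, rfl⟩ := autQuot_surjective hA ψ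
  exact ⟨(f : Out (G n)), rfl⟩

lemma isShortExact_mk' {K H : Type*} [Group K] [Group H] {f : K →* H} (N : Subgroup H) [N.Normal]
    (hf : Function.Injective f) (hN : f.range = N) : IsShortExact f (QuotientGroup.mk' N) :=
  ⟨hf, hN.trans (QuotientGroup.ker_mk' N).symm, QuotientGroup.mk'_surjective N⟩

end HantzscheWendt

theorem theorem4p4 (n : ℕ) (hn : 3 ≤ n) :
    ∃ hA : (HantzscheWendt.A n).Characteristic,
      -- the four squares commute
      ((HantzscheWendt.t n).comp (HantzscheWendt.iota n) =
          (MulAut.conj : HantzscheWendt.G n →* MulAut (HantzscheWendt.G n)).comp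
            (HantzscheWendt.A n).subtype ∧
        (HantzscheWendt.autQuot (HantzscheWendt.A n) hA).comp MulAut.conj =
          (MulAut.conj : HantzscheWendt.W n →* MulAut (HantzscheWendt.W n)).comp
            (QuotientGroup.mk' (HantzscheWendt.A n)) ∧
        (HantzscheWendt.tOut n).comp (QuotientGroup.mk' (HantzscheWendt.iota n).range) =
          (HantzscheWendt.toOut (HantzscheWendt.G n)).comp (HantzscheWendt.t n) ∧
        (HantzscheWendt.outQuot (HantzscheWendt.A n) hA).comp
            (HantzscheWendt.toOut (HantzscheWendt.G n)) =
          (HantzscheWendt.toOut (HantzscheWendt.W n)).comp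
            (HantzscheWendt.autQuot (HantzscheWendt.A n) hA)) ∧
      -- the three rows are exact
      (HantzscheWendt.IsShortExact (HantzscheWendt.A n).subtype
          (QuotientGroup.mk' (HantzscheWendt.A n)) ∧
        HantzscheWendt.IsShortExact (HantzscheWendt.t n)
          (HantzscheWendt.autQuot (HantzscheWendt.A n) hA) ∧
        HantzscheWendt.IsShortExact (HantzscheWendt.tOut n)
          (HantzscheWendt.outQuot (HantzscheWendt.A n) hA)) ∧
      -- the three columns are exact
      (HantzscheWendt.IsShortExact (HantzscheWendt.iota n)
          (QuotientGroup.mk' (HantzscheWendt.iota n).range) ∧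
        HantzscheWendt.IsShortExact
          (MulAut.conj : HantzscheWendt.G n →* MulAut (HantzscheWendt.G n))
          (HantzscheWendt.toOut (HantzscheWendt.G n)) ∧
        HantzscheWendt.IsShortExact
          (MulAut.conj : HantzscheWendt.W n →* MulAut (HantzscheWendt.W n))
          (HantzscheWendt.toOut (HantzscheWendt.W n))) := by
  have hA := HantzscheWendt.A_characteristic hn
  refine ⟨hA, ⟨MonoidHom.ext HantzscheWendt.t_iota,
    MonoidHom.ext (HantzscheWendt.autQuot_conj _ hA), rfl, rfl⟩, ⟨?_, ?_, ?_⟩, ?_, ?_, ?_⟩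
  · exact HantzscheWendt.isShortExact_mk' _ (Subgroup.subtype_injective _) (Subgroup.range_subtype _)
  · exact ⟨HantzscheWendt.t_injective n, HantzscheWendt.range_t hA,
      HantzscheWendt.autQuot_surjective hA⟩
  · exact ⟨HantzscheWendt.tOut_injective hn, HantzscheWendt.range_tOut hA,
      HantzscheWendt.outQuot_surjective hA⟩
  · exact HantzscheWendt.isShortExact_mk' _ (HantzscheWendt.iota_injective (by omega)) rfl
  · exact HantzscheWendt.isShortExact_mk' _ (HantzscheWendt.conj_G_injective hn) rfl
  · exact HantzscheWendt.isShortExact_mk' _ (HantzscheWendt.conj_W_injective hn) rfl
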